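/- Let $\Gamma=\Gamma(V,E)$ be a simple undirected graph and let $\mathcal{M}=\{M_\alpha:\alpha\in V\}$ be a family of mutually disjoint monoids, with identities $1_\alpha$. The graph product $\mathscr{GP}(\Gamma,\mathcal{M})$ is the monoid given by the monoid presentation $\langle X\mid R\rangle$, where $X=\bigcup_{\alpha\in V}M_\alpha$ and, writing $\circ$ for concatenation of words and $\epsilon$ for the empty word, $R$ consists of the relations $1_\alpha=\epsilon$ ($\alpha\in V$), $x\circ y=xy$ ($x,y\in M_\alpha$, $\alpha\in V$), and $x\circ y=y\circ x$ ($x\in M_\alpha$, $y\in M_\beta$, $\{\alpha,\beta\}\in E$). Write $[w]$ for the class of a word $w$ in $\mathscr{GP}(\Gamma,\mathcal{M})$. An element $a$ of a monoid $S$ is regular if $a=aba$ for some $b\in S$, and $S$ is regular if all its elements are. For $a,b\in S$ write $a\,\mathcal{R}^*\,b$ if for all $x,y\in S$ we have $xa=ya\iff xb=yb$, and $a\,\mathcal{L}^*\,b$ if for all $x,y\in S$ we have $ax=ay\iff bx=by$. The monoid $S$ is left (right) abundant if every element of $S$ is $\mathcal{R}^*$-related ($\mathcal{L}^*$-related) to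 an idempotent of $S$, and abundant if it is both left and right abundant. **Corollary 5.20.** If every $M_\alpha$ is regular, then $\mathscr{GP}(\Gamma,\mathcal{M})$ is abundant. Such a graph product need not be regular: if $M_1,M_2$ are regular monoids and $m\in M_1$, $n\in M_2$ are elements that have neither a left nor a right inverse, then $[m\circ n]$ is not regular in the free product of $M_1$ and $M_2$, that is, in $\mathscr{GP}(\Gamma,\{M_1,M_2\})$ for the graph $\Gamma=(\{1,2\},\emptyset)$. In particular, there are regular monoids $M_1,M_2$ whose free product is not regular. -/

import Mathlib

universe u v

/-- An element `a` of a monoid is (von Neumann) regular if `a = a b a` for some `b`.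
This is unrelated to Mathlib's `IsRegular`, which means cancellable. -/
def IsVonNeumannRegular {S : Type*} [Monoid S] (a : S) : Prop :=
  ∃ b : S, a = a * b * a

/-- A monoid is regular if all its elements are (von Neumann) regular. -/
def IsRegularMonoid (S : Type*) [Monoid S] : Prop :=
  ∀ a : S, IsVonNeumannRegular a

/-- The relation `R*`: `a R* b` if for all `x, y` we have `x a = y a` iff `x b = y b`. -/
def RStar {S : Type*} [Monoid S] (a b : S) : Prop :=
  ∀ x y : S, x * a = y * a ↔ x * b = y * b

/-- The relation `L*`, the left-right dual of `R*`. -/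
def LStar {S : Type*} [Monoid S] (a b : S) : Prop :=
  ∀ x y : S, a * x = a * y ↔ b * x = b * y

/-- A monoid is left abundant if every element is `R*`-related to an idempotent. -/
def IsLeftAbundant (S : Type*) [Monoid S] : Prop :=
  ∀ a : S, ∃ e : S, IsIdempotentElem e ∧ RStar a e

/-- A monoid is right abundant if every element is `L*`-related to an idempotent. -/
def IsRightAbundant (S : Type*) [Monoid S] : Prop :=
  ∀ a : S, ∃ e : S, IsIdempotentElem e ∧ LStar a e

/-- A monoid is abundant if it is both left and right abundant. -/
def IsAbundant (S : Type*) [Monoid S] : Prop :=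
  IsLeftAbundant S ∧ IsRightAbundant S

/-- The defining relations of the graph product, on the free monoid over the disjoint union
`Σ i, M i` of the vertex monoids. -/
inductive GraphProductRel {V : Type u} (Γ : SimpleGraph V) (M : V → Type v)
    [∀ i, Monoid (M i)] : FreeMonoid (Σ i, M i) → FreeMonoid (Σ i, M i) → Prop
  | id (i : V) : GraphProductRel Γ M (FreeMonoid.of ⟨i, 1⟩) 1
  | vertex (i : V) (x y : M i) :
      GraphProductRel Γ M (FreeMonoid.of ⟨i, x⟩ * FreeMonoid.of ⟨i, y⟩)
        (FreeMonoid.of ⟨i, x * y⟩)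
  | edge (i j : V) (h : Γ.Adj i j) (x : M i) (y : M j) :
      GraphProductRel Γ M (FreeMonoid.of ⟨i, x⟩ * FreeMonoid.of ⟨j, y⟩)
        (FreeMonoid.of ⟨j, y⟩ * FreeMonoid.of ⟨i, x⟩)

/-- The graph product of the monoids `M i` with respect to `Γ`: the quotient of the free monoid
over `Σ i, M i` by the congruence generated by `GraphProductRel Γ M`. -/
abbrev GraphProduct {V : Type u} (Γ : SimpleGraph V) (M : V → Type v)
    [∀ i, Monoid (M i)] : Type (max u v) :=
  PresentedMonoid (GraphProductRel Γ M)

/-- The class `[x]` in the graph product of a one-letter word `x ∈ M i`. -/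
def GraphProduct.of {V : Type u} (Γ : SimpleGraph V) (M : V → Type v)
    [∀ i, Monoid (M i)] (i : V) (x : M i) : GraphProduct Γ M :=
  PresentedMonoid.of (GraphProductRel Γ M) ⟨i, x⟩

/-! Reduced words are unique up to shuffling, so an element factors uniquely as `c * z` with `c` in
a chosen vertex monoid and `z` having no initial letter there; hence such a `c` cancels on the left
(`of_mul_cancel`).

For right abundance, factor an element as `w * v` with the vertices of `v` pairwise adjacent, and
shorten it when possible. A right invertible letter of `v` can be moved to the end and stripped off,
which preserves being `L*`-related to an idempotent (`exists_lStar_mul_of_mul_eq_one`). Once no such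
letter remains and no shortening applies (`blockedOver_or_exists_shorter`), every letter of `w`
stays blocked whatever is multiplied on the right of `v`, so `w` cancels (`BlockedOver.cancel`) and
`w * v` is `L*`-related to `v`. Letters of `v` commute and are regular, so `v = v * b * v` for some
`b`, and `b * v` is the idempotent sought. Left abundance follows by passing to opposites.

For non-regularity, cancel `m` in `m n = m n b m n` and retract onto the monoid of `m`: a left
inverse of `m` appears. -/

namespace GraphProduct

variable {V : Type u} (Γ : SimpleGraph V) (M : V → Type v)

/-! ### Piles: words up to shuffling -/

section Piles

/-- The pair of vertices `p` is a non-edge containing `i`. -/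
def Touches (i : V) (p : V × V) : Prop := (p.1 = i ∨ p.2 = i) ∧ ¬ Γ.Adj p.1 p.2

/-- A family of words indexed by pairs of vertices. A reduced word gives rise to the family of its
projections onto the non-edges of the graph, which determines it up to shuffling. -/
abbrev Pile (M : V → Type v) : Type (max u v) := V × V → List (Σ i, M i)

variable {Γ M}

theorem touches_self (i : V) : Touches Γ i (i, i) := by simp [Touches]

theorem touches_of_not_adj {i j : V} (h : ¬ Γ.Adj i j) :
    Touches Γ i (i, j) ∧ Touches Γ j (i, j) := by simp [Touches, h]

theorem not_touches_of_adj {i j : V} (h : Γ.Adj i j) {p : V × V} (hi : Touches Γ i p) :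
    ¬ Touches Γ j p := by
  rintro ⟨hj, -⟩
  obtain ⟨hi, hn⟩ := hi
  have hne := h.ne
  rcases hi with rfl | rfl <;> rcases hj with hj | hj
  · exact hne hj
  · exact hn (hj ▸ h)
  · exact hn (hj ▸ h.symm)
  · exact hne hj

variable (Γ) in
open Classical in
/-- Put the letter `c` from the vertex monoid at `i` in front of a pile. -/
noncomputable def push (i : V) (c : M i) (f : Pile M) : Pile M :=
  fun p => if Touches Γ i p then ⟨i, c⟩ :: f p else f p

variable (Γ) in
/-- No letter from the vertex monoid at `i` can be shuffled to the front of the pile. -/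
def Clean (i : V) (f : Pile M) : Prop :=
  ¬ ∃ c : M i, ∀ p, Touches Γ i p → (f p).head? = some ⟨i, c⟩

theorem push_apply {i : V} {p : V × V} (h : Touches Γ i p) (c : M i) (f : Pile M) :
    push Γ i c f p = ⟨i, c⟩ :: f p := if_pos h

theorem push_apply_of_not {i : V} {p : V × V} (h : ¬ Touches Γ i p) (c : M i) (f : Pile M) :
    push Γ i c f p = f p := if_neg h

theorem push_injective {i : V} {c d : M i} {f g : Pile M} (h : push Γ i c f = push Γ i d g) :
    c = d ∧ f = g := by
  constructor
  · have := congrFun h (i, i)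
    simp only [push_apply (touches_self i), List.cons.injEq, Sigma.mk.injEq, heq_eq_eq,
      true_and] at this
    exact this.1
  · funext p
    have := congrFun h p
    by_cases hp : Touches Γ i p
    · simp only [push_apply hp] at this
      exact (List.cons.inj this).2
    · simpa only [push_apply_of_not hp] using this

theorem push_comm {i j : V} (h : Γ.Adj i j) (c : M i) (d : M j) (f : Pile M) :
    push Γ i c (push Γ j d f) = push Γ j d (push Γ i c f) := by
  funext p
  by_cases hi : Touches Γ i p
  · have hj := not_touches_of_adj h hi
    simp only [push_apply hi, push_apply_of_not hj]
  · by_cases hj : Touches Γ j p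
    · simp only [push_apply hj, push_apply_of_not hi]
    · simp only [push_apply_of_not hj, push_apply_of_not hi]

theorem not_clean_push (i : V) (c : M i) (f : Pile M) : ¬ Clean Γ i (push Γ i c f) :=
  fun h => h ⟨c, fun p hp => by rw [push_apply hp]; rfl⟩

theorem clean_nil (i : V) : Clean Γ i (fun _ => [] : Pile M) := by
  rintro ⟨c, hc⟩
  simpa using hc _ (touches_self i)

theorem clean_push_of_adj {i j : V} (h : Γ.Adj i j) (d : M j) (f : Pile M) :
    Clean Γ i (push Γ j d f) ↔ Clean Γ i f := by
  unfold Clean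
  refine not_congr (exists_congr fun c => forall_congr' fun p => imp_congr_right fun hp => ?_)
  rw [push_apply_of_not (not_touches_of_adj h hp)]

/-- The pair `(i, j)` touches both vertices, and its list now begins with the letter from `j`. -/
theorem clean_push_of_not_adj {i j : V} (hne : i ≠ j) (h : ¬ Γ.Adj i j) (d : M j) (f : Pile M) :
    Clean Γ i (push Γ j d f) := by
  rintro ⟨c, hc⟩
  have := hc _ (touches_of_not_adj h).1
  rw [push_apply (touches_of_not_adj h).2] at this
  simp only [List.head?_cons, Option.some.injEq, Sigma.mk.injEq] at this
  exact hne this.1.symm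

variable [∀ i, Monoid (M i)]

variable (Γ) in
open Classical in
/-- `push`, with the convention that identity elements leave a pile unchanged. -/
noncomputable def push₁ (i : V) (c : M i) (f : Pile M) : Pile M :=
  if c = 1 then f else push Γ i c f

@[simp] theorem push₁_one (i : V) (f : Pile M) : push₁ Γ i 1 f = f := if_pos rfl

theorem push₁_of_ne {i : V} {c : M i} (h : c ≠ 1) (f : Pile M) : push₁ Γ i c f = push Γ i c f :=
  if_neg h

theorem push₁_injective {i : V} {c d : M i} {f g : Pile M} (hf : Clean Γ i f) (hg : Clean Γ i g)
    (h : push₁ Γ i c f = push₁ Γ i d g) : c = d ∧ f = g := by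
  by_cases hc : c = 1 <;> by_cases hd : d = 1
  · subst hc hd; simpa using h
  · subst hc
    rw [push₁_one, push₁_of_ne hd] at h
    exact absurd (h ▸ hf) (not_clean_push _ _ _)
  · subst hd
    rw [push₁_one, push₁_of_ne hc] at h
    exact absurd (h ▸ hg) (not_clean_push _ _ _)
  · rw [push₁_of_ne hc, push₁_of_ne hd] at h
    exact push_injective h

theorem push₁_comm {i j : V} (h : Γ.Adj i j) (c : M i) (d : M j) (f : Pile M) :
    push₁ Γ i c (push₁ Γ j d f) = push₁ Γ j d (push₁ Γ i c f) := by
  unfold push₁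
  split_ifs <;> first | rfl | exact push_comm h c d f

theorem clean_push₁_of_adj {i j : V} (h : Γ.Adj i j) (d : M j) (f : Pile M) :
    Clean Γ i (push₁ Γ j d f) ↔ Clean Γ i f := by
  unfold push₁
  split_ifs
  · rfl
  · exact clean_push_of_adj h d f

end Piles

/-! ### Reduced words and their uniqueness -/

variable {Γ M} [∀ i, Monoid (M i)]

theorem of_one (i : V) : of Γ M i 1 = 1 :=
  PresentedMonoid.mk_eq_mk_of_rel (GraphProductRel.id i)

theorem of_mul (i : V) (x y : M i) : of Γ M i (x * y) = of Γ M i x * of Γ M i y :=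
  (PresentedMonoid.mk_eq_mk_of_rel (GraphProductRel.vertex i x y)).symm

theorem of_comm {i j : V} (h : Γ.Adj i j) (x : M i) (y : M j) :
    of Γ M i x * of Γ M j y = of Γ M j y * of Γ M i x :=
  PresentedMonoid.mk_eq_mk_of_rel (GraphProductRel.edge i j h x y)

theorem of_mul_left_comm {i j : V} (h : Γ.Adj i j) (x : M i) (y : M j) (z : GraphProduct Γ M) :
    of Γ M i x * (of Γ M j y * z) = of Γ M j y * (of Γ M i x * z) := by
  rw [← mul_assoc, of_comm h, mul_assoc]

theorem of_mul_induction {P : GraphProduct Γ M → Prop} (one : P 1)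
    (of_mul : ∀ i c z, P z → P (of Γ M i c * z)) (z : GraphProduct Γ M) : P z := by
  obtain ⟨w, rfl⟩ := PresentedMonoid.surjective_mk z
  induction w using FreeMonoid.inductionOn' with
  | one => exact one
  | of_mul b a ih => exact of_mul b.1 b.2 _ ih

variable (Γ M) in
/-- `Represents f z` says that `f` is the pile of a reduced word for `z`. -/
inductive Represents : Pile M → GraphProduct Γ M → Prop
  | nil : Represents (fun _ => []) 1
  | push {i : V} {c : M i} {f : Pile M} {z : GraphProduct Γ M} (hz : Represents f z)
      (hf : Clean Γ i f) (hc : c ≠ 1) : Represents (push Γ i c f) (of Γ M i c * z)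

theorem Represents.push₁ {i : V} {f : Pile M} {z : GraphProduct Γ M}
    (hz : Represents Γ M f z) (hf : Clean Γ i f) (c : M i) :
    Represents Γ M (push₁ Γ i c f) (of Γ M i c * z) := by
  by_cases hc : c = 1
  · subst hc; simpa [of_one] using hz
  · rw [push₁_of_ne hc]; exact hz.push hf hc

/-- A head letter at an adjacent vertex commutes past the extracted letter; a head letter at any
other vertex different from `i` blocks `i`, and `c = 1` serves. -/
theorem Represents.exists_eq_push₁ {f : Pile M} {z : GraphProduct Γ M}
    (h : Represents Γ M f z) (i : V) : ∃ (c : M i) (g : Pile M) (z' : GraphProduct Γ M),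
      f = GraphProduct.push₁ Γ i c g ∧ Clean Γ i g ∧ Represents Γ M g z' ∧
        z = of Γ M i c * z' := by
  induction h with
  | nil => exact ⟨1, _, 1, by simp, clean_nil i, .nil, by simp [of_one]⟩
  | @push j d f z hz hf hd ih =>
    by_cases hij : i = j
    · subst hij
      exact ⟨d, f, z, (push₁_of_ne hd f).symm, hf, hz, rfl⟩
    by_cases hadj : Γ.Adj i j
    · obtain ⟨c, g, z', rfl, hg, hgz, rfl⟩ := ih
      rw [clean_push₁_of_adj hadj.symm] at hf
      refine ⟨c, GraphProduct.push₁ Γ j d g, of Γ M j d * z', ?_, ?_, hgz.push₁ hf d, ?_⟩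
      · rw [push₁_comm hadj, push₁_of_ne hd]
      · rwa [clean_push₁_of_adj hadj]
      · rw [of_mul_left_comm hadj]
    · exact ⟨1, _, _, (push₁_one i _).symm, clean_push_of_not_adj hij hadj d f, hz.push hf hd,
        by rw [of_one, one_mul]⟩

theorem Represents.right_unique {f : Pile M} {z z' : GraphProduct Γ M}
    (h : Represents Γ M f z) (h' : Represents Γ M f z') : z = z' := by
  induction h generalizing z' with
  | nil =>
    generalize hg : (fun _ => [] : Pile M) = g at h'
    cases h' with
    | nil => rfl
    | @push j d f z hz hf hd => exact absurd (hg ▸ clean_nil j) (not_clean_push j d f)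
  | @push j d f z hz hf hd ih =>
    obtain ⟨c, g, z'', hg, hclean, hgz, rfl⟩ := h'.exists_eq_push₁ j
    rw [← push₁_of_ne hd] at hg
    obtain ⟨rfl, rfl⟩ := push₁_injective hf hclean hg
    rw [ih hgz]

variable (Γ M) in
/-- The piles of reduced words. -/
def ReducedPile : Type (max u v) := {f : Pile M // ∃ z, Represents Γ M f z}

namespace ReducedPile

theorem exists_eq_push₁ (f : ReducedPile Γ M) (i : V) :
    ∃ q : M i × ReducedPile Γ M, f.1 = push₁ Γ i q.1 q.2.1 ∧ Clean Γ i q.2.1 := by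
  obtain ⟨f, z, hz⟩ := f
  obtain ⟨c, g, z', rfl, hg, hgz, rfl⟩ := hz.exists_eq_push₁ i
  exact ⟨(c, ⟨g, z', hgz⟩), rfl, hg⟩

/-- The action of a letter on reduced piles. -/
noncomputable def act (i : V) (c : M i) (f : ReducedPile Γ M) : ReducedPile Γ M :=
  ⟨push₁ Γ i (c * (f.exists_eq_push₁ i).choose.1) (f.exists_eq_push₁ i).choose.2.1,
    let ⟨_, hz⟩ := (f.exists_eq_push₁ i).choose.2.2
    ⟨_, hz.push₁ (f.exists_eq_push₁ i).choose_spec.2 _⟩⟩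

/-- By `push₁_injective`, the decomposition chosen in `act` is the only one. -/
theorem act_of_eq {i : V} {d : M i} {f g : ReducedPile Γ M} (hf : f.1 = push₁ Γ i d g.1)
    (hg : Clean Γ i g.1) (c : M i) : (act i c f).1 = push₁ Γ i (c * d) g.1 := by
  obtain ⟨h₁, h₂⟩ := (f.exists_eq_push₁ i).choose_spec
  obtain ⟨h₃, h₄⟩ := push₁_injective h₂ hg (h₁.symm.trans hf)
  simp only [act, h₃, h₄]

theorem act_of_clean {i : V} {f : ReducedPile Γ M} (hf : Clean Γ i f.1) (c : M i) :
    (act i c f).1 = push₁ Γ i c f.1 := by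
  rw [act_of_eq (push₁_one i f.1).symm hf, mul_one]

theorem act_one (i : V) (f : ReducedPile Γ M) : act i 1 f = f := by
  obtain ⟨⟨d, g⟩, hf, hg⟩ := f.exists_eq_push₁ i
  apply Subtype.ext
  rw [act_of_eq hf hg, one_mul, hf]

theorem act_act (i : V) (x y : M i) (f : ReducedPile Γ M) :
    act i x (act i y f) = act i (x * y) f := by
  obtain ⟨⟨d, g⟩, hf, hg⟩ := f.exists_eq_push₁ i
  apply Subtype.ext
  rw [act_of_eq (act_of_eq hf hg y) hg, act_of_eq hf hg, mul_assoc]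

theorem act_comm {i j : V} (h : Γ.Adj i j) (x : M i) (y : M j) (f : ReducedPile Γ M) :
    act i x (act j y f) = act j y (act i x f) := by
  -- Extract the letters `c` at `i` and `d` at `j`, leaving a pile `k` clean at both vertices; the
  -- two actions then change `c` and `d` independently.
  obtain ⟨⟨c, g⟩, hf, hg⟩ := f.exists_eq_push₁ i
  obtain ⟨⟨d, k⟩, hg', hk⟩ := g.exists_eq_push₁ j
  dsimp only at hf hg hg' hk
  rw [hg', clean_push₁_of_adj h] at hg
  have hf' : f.1 = push₁ Γ j d (act i c k).1 := by
    rw [hf, hg', act_of_clean hg, push₁_comm h]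
  have clean_i (y : M j) : Clean Γ i (act j y k).1 := by
    rwa [act_of_clean hk, clean_push₁_of_adj h]
  have clean_j (x : M i) : Clean Γ j (act i x k).1 := by
    rwa [act_of_clean hg, clean_push₁_of_adj h.symm]
  have h₁ : (act j y f).1 = push₁ Γ i c (act j (y * d) k).1 := by
    rw [act_of_eq hf' (clean_j c), act_of_clean hk, act_of_clean hg, push₁_comm h]
  have h₂ : (act i x f).1 = push₁ Γ j d (act i (x * c) k).1 := by
    rw [act_of_eq hf (by rwa [hg', clean_push₁_of_adj h]), hg', act_of_clean hg, push₁_comm h]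
  apply Subtype.ext
  rw [act_of_eq h₁ (clean_i _), act_of_eq h₂ (clean_j _), act_of_clean hk, act_of_clean hg,
    push₁_comm h]

end ReducedPile

variable (Γ M) in
/-- The action of a graph product on reduced piles. -/
noncomputable def toEnd : GraphProduct Γ M →* Function.End (ReducedPile Γ M) :=
  PresentedMonoid.lift (M := Function.End (ReducedPile Γ M)) (fun l => ReducedPile.act l.1 l.2) (by
    intro a b h
    cases h with
    | id i => funext f; exact ReducedPile.act_one i f
    | vertex i x y => funext f; exact ReducedPile.act_act i x y f
    | edge i j h x y => funext f; exact ReducedPile.act_comm h x y f)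

/-- The pile of the reduced words of an element of a graph product. -/
noncomputable def pile (z : GraphProduct Γ M) : ReducedPile Γ M :=
  toEnd Γ M z ⟨fun _ => [], 1, .nil⟩

theorem pile_one : (pile (1 : GraphProduct Γ M)).1 = fun _ => [] := by
  simp only [pile, map_one]; rfl

theorem pile_of_mul (i : V) (c : M i) (z : GraphProduct Γ M) :
    pile (of Γ M i c * z) = (pile z).act i c := by
  simp only [pile, map_mul]; rfl

theorem Represents.pile_eq {f : Pile M} {z : GraphProduct Γ M} (h : Represents Γ M f z) :
    (pile z).1 = f := by
  induction h with
  | nil => exact pile_one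
  | @push j d f z hz hf hd ih =>
    rw [pile_of_mul, ReducedPile.act_of_clean (by rwa [ih]), ih, push₁_of_ne hd]

theorem represents_pile (z : GraphProduct Γ M) : Represents Γ M (pile z).1 z := by
  induction z using of_mul_induction with
  | one => rw [pile_one]; exact .nil
  | of_mul i c z ih =>
    obtain ⟨d, g, z', hf, hg, hgz, rfl⟩ := ih.exists_eq_push₁ i
    rw [← mul_assoc, ← of_mul, pile_of_mul, ReducedPile.act_of_clean (by rwa [hgz.pile_eq]),
      hgz.pile_eq]
    exact hgz.push₁ hg _

/-! ### Initial letters and cancellation -/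

variable (Γ) in
/-- No reduced word for `z` starts with a letter from the vertex monoid at `i`. -/
def NotInitial (i : V) (z : GraphProduct Γ M) : Prop := Clean Γ i (pile z).1

theorem pile_of_mul_of_notInitial {i : V} {z : GraphProduct Γ M} (h : NotInitial Γ i z)
    (c : M i) : (pile (of Γ M i c * z)).1 = push₁ Γ i c (pile z).1 := by
  rw [pile_of_mul, ReducedPile.act_of_clean h]

theorem exists_eq_of_mul (i : V) (z : GraphProduct Γ M) :
    ∃ c z', z = of Γ M i c * z' ∧ NotInitial Γ i z' := by
  obtain ⟨d, g, z', hf, hg, hgz, rfl⟩ := (represents_pile z).exists_eq_push₁ i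
  exact ⟨d, z', rfl, by rwa [NotInitial, hgz.pile_eq]⟩

theorem of_mul_cancel {i : V} {c : M i} {z z' : GraphProduct Γ M}
    (hz : NotInitial Γ i z) (hz' : NotInitial Γ i z')
    (h : of Γ M i c * z = of Γ M i c * z') : z = z' := by
  have := congrArg (fun z => (pile z).1) h
  simp only [pile_of_mul_of_notInitial hz, pile_of_mul_of_notInitial hz'] at this
  have := (push₁_injective hz hz' this).2
  exact (represents_pile z).right_unique (this ▸ represents_pile z')

theorem NotInitial.of_mul_of_adj {i j : V} (hij : Γ.Adj i j) {z : GraphProduct Γ M}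
    (hz : NotInitial Γ i z) (c : M j) : NotInitial Γ i (of Γ M j c * z) := by
  obtain ⟨d, z, rfl, hj⟩ := exists_eq_of_mul j z
  rw [NotInitial, pile_of_mul_of_notInitial hj, clean_push₁_of_adj hij] at hz
  rw [← mul_assoc, ← of_mul, NotInitial, pile_of_mul_of_notInitial hj, clean_push₁_of_adj hij]
  exact hz

theorem NotInitial.of_mul_of_not_adj {i j : V} (hne : i ≠ j) (hij : ¬ Γ.Adj i j)
    {z : GraphProduct Γ M} (hz : NotInitial Γ j z) {c : M j} (hc : c ≠ 1) :
    NotInitial Γ i (of Γ M j c * z) := by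
  rw [NotInitial, pile_of_mul_of_notInitial hz, push₁_of_ne hc]
  exact clean_push_of_not_adj hne hij c _

/-- Whatever letter `d` of `z` is absorbed by `c`, the product `c * d` is nontrivial and keeps
blocking `i`. -/
theorem notInitial_of_mul_of_not_adj {i j : V} (hne : i ≠ j) (hij : ¬ Γ.Adj i j) {c : M j}
    (hc : ∀ d, c * d ≠ 1) (z : GraphProduct Γ M) : NotInitial Γ i (of Γ M j c * z) := by
  obtain ⟨d, z, rfl, hj⟩ := exists_eq_of_mul j z
  rw [← mul_assoc, ← of_mul]
  exact hj.of_mul_of_not_adj hne hij (hc d)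

end GraphProduct

/-! ### Blocked words and clique words -/

namespace GraphProduct

variable {V : Type u} {Γ : SimpleGraph V} {M : V → Type v}

variable (Γ) in
/-- Some letter of the word neither belongs to nor commutes with the vertex monoid at `i`, and no
letter before it belongs to this vertex monoid. -/
def Blocked (i : V) : List (Σ i, M i) → Prop
  | [] => False
  | l :: L => l.1 ≠ i ∧ (¬ Γ.Adj i l.1 ∨ Blocked i L)

theorem blocked_or (i : V) (L : List (Σ i, M i)) :
    Blocked Γ i L ∨ (∀ l ∈ L, Γ.Adj i l.1) ∨
      ∃ L₁ c L₂, L = L₁ ++ ⟨i, c⟩ :: L₂ ∧ ∀ l ∈ L₁, Γ.Adj i l.1 := by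
  induction L with
  | nil => simp
  | cons l L ih =>
    by_cases hl : l.1 = i
    · subst hl
      exact .inr (.inr ⟨[], l.2, L, rfl, by simp⟩)
    by_cases hadj : Γ.Adj i l.1
    · rcases ih with h | h | ⟨L₁, c, L₂, rfl, h⟩
      · exact .inl ⟨hl, .inr h⟩
      · exact .inr (.inl (by simpa [hadj] using h))
      · exact .inr (.inr ⟨l :: L₁, c, L₂, rfl, by simpa [hadj] using h⟩)
    · exact .inl ⟨hl, .inl hadj⟩

theorem Blocked.append {i : V} {L : List (Σ i, M i)} (h : Blocked Γ i L) (L' : List (Σ i, M i)) :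
    Blocked Γ i (L ++ L') := by
  induction L with
  | nil => exact h.elim
  | cons l L ih => exact ⟨h.1, h.2.imp_right ih⟩

theorem Blocked.append_of_adj {i : V} {L L' : List (Σ i, M i)} (h : Blocked Γ i L')
    (hL : ∀ l ∈ L, Γ.Adj i l.1) : Blocked Γ i (L ++ L') := by
  induction L with
  | nil => exact h
  | cons l L ih =>
    exact ⟨(hL l (by simp)).ne', .inr (ih fun l hl => hL l (by simp [hl]))⟩

variable [∀ i, Monoid (M i)]

variable (Γ M) in
/-- The class of a word. -/
def word (L : List (Σ i, M i)) : GraphProduct Γ M := (L.map fun l => of Γ M l.1 l.2).prod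

@[simp] theorem word_nil : word Γ M [] = 1 := rfl

@[simp] theorem word_cons (l : Σ i, M i) (L : List (Σ i, M i)) :
    word Γ M (l :: L) = of Γ M l.1 l.2 * word Γ M L := by simp [word]

@[simp] theorem word_append (L L' : List (Σ i, M i)) :
    word Γ M (L ++ L') = word Γ M L * word Γ M L' := by simp [word]

theorem exists_word_eq (z : GraphProduct Γ M) : ∃ L, word Γ M L = z := by
  induction z using of_mul_induction with
  | one => exact ⟨[], rfl⟩
  | of_mul i c z ih =>
    obtain ⟨L, rfl⟩ := ih
    exact ⟨⟨i, c⟩ :: L, word_cons _ _⟩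

theorem of_mul_word {i : V} {L : List (Σ i, M i)} (h : ∀ l ∈ L, Γ.Adj i l.1) (c : M i) :
    of Γ M i c * word Γ M L = word Γ M L * of Γ M i c := by
  induction L with
  | nil => simp
  | cons l L ih =>
    rw [word_cons, of_mul_left_comm (h l (by simp)), ih fun l hl => h l (by simp [hl]), mul_assoc]

theorem of_mul_word_append {i : V} {L₁ L₂ : List (Σ i, M i)} (h : ∀ l ∈ L₁, Γ.Adj i l.1)
    (c d : M i) :
    of Γ M i c * word Γ M (L₁ ++ ⟨i, d⟩ :: L₂) = word Γ M (L₁ ++ ⟨i, c * d⟩ :: L₂) := by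
  simp only [word_append, word_cons, of_mul]
  rw [← mul_assoc, of_mul_word h]
  simp only [mul_assoc]

/-- Prepending any letter of the word to the product of the letters after it with an arbitrary
element produces an element starting with a letter from the same vertex monoid. -/
def Persistent (Γ : SimpleGraph V) : List (Σ i, M i) → Prop
  | [] => True
  | l :: L => Persistent Γ L ∧ ((∀ d, l.2 * d ≠ 1) ∨ l.2 ≠ 1 ∧ Blocked Γ l.1 L)

/-- Letters adjacent to `i` are transparent. The first other letter survives: either nothing it
absorbs makes it trivial, or it is nontrivial and the letters after it keep it from absorbing
anything. -/
theorem Persistent.notInitial {L : List (Σ i, M i)} (hL : Persistent Γ L) {i : V}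
    (h : Blocked Γ i L) (x : GraphProduct Γ M) : NotInitial Γ i (word Γ M L * x) := by
  induction L generalizing i with
  | nil => exact h.elim
  | cons l L ih =>
    rw [word_cons, mul_assoc]
    by_cases hadj : Γ.Adj i l.1
    · exact (ih hL.1 (h.2.resolve_left (not_not.2 hadj))).of_mul_of_adj hadj _
    · rcases hL.2 with hl | ⟨hl, hb⟩
      · exact notInitial_of_mul_of_not_adj h.1.symm hadj hl _
      · exact (ih hL.1 hb).of_mul_of_not_adj h.1.symm hadj hl

/-- The letters of `w` are nontrivial and blocked by the letters after them in `w ++ v`. -/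
def BlockedOver (Γ : SimpleGraph V) (v : List (Σ i, M i)) : List (Σ i, M i) → Prop
  | [] => True
  | l :: w => BlockedOver Γ v w ∧ l.2 ≠ 1 ∧ Blocked Γ l.1 (w ++ v)

theorem BlockedOver.persistent {v w : List (Σ i, M i)} (h : BlockedOver Γ v w)
    (hv : Persistent Γ v) : Persistent Γ (w ++ v) := by
  induction w with
  | nil => exact hv
  | cons l w ih => exact ⟨ih h.1, .inr h.2⟩

theorem BlockedOver.cancel {v w : List (Σ i, M i)} (h : BlockedOver Γ v w)
    (hv : Persistent Γ v) {x y : GraphProduct Γ M}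
    (hxy : word Γ M w * (word Γ M v * x) = word Γ M w * (word Γ M v * y)) :
    word Γ M v * x = word Γ M v * y := by
  induction w with
  | nil => simpa using hxy
  | cons l w ih =>
    refine ih h.1 ?_
    have key (x) : NotInitial Γ l.1 (word Γ M w * (word Γ M v * x)) := by
      rw [← mul_assoc, ← word_append]
      exact (h.1.persistent hv).notInitial h.2.2 x
    rw [word_cons, mul_assoc, mul_assoc] at hxy
    exact of_mul_cancel (key x) (key y) hxy

/-- The letters of the word belong to pairwise adjacent vertices. -/
def IsCliqueWord (Γ : SimpleGraph V) (L : List (Σ i, M i)) : Prop :=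
  L.Pairwise fun l l' => Γ.Adj l.1 l'.1

/-- An unblocked letter of `w` is trivial, merges with a later letter of `w` or `v`, or commutes
with everything after it and joins the clique `v`. Letters of `w` count twice so that this last move
also lowers the measure. -/
theorem blockedOver_or_exists_shorter (w : List (Σ i, M i)) {v : List (Σ i, M i)}
    (hv : IsCliqueWord Γ v) : BlockedOver Γ v w ∨ ∃ w' v' : List (Σ i, M i),
      IsCliqueWord Γ v' ∧ word Γ M w' * word Γ M v' = word Γ M w * word Γ M v ∧
        2 * w'.length + v'.length < 2 * w.length + v.length := by
  induction w with
  | nil => exact .inl trivial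
  | cons l w ih =>
    rcases ih with ih | ⟨w', v', hv', h, hlt⟩
    swap
    · refine .inr ⟨l :: w', v', hv', ?_, ?_⟩
      · rw [word_cons, word_cons, mul_assoc, h, mul_assoc]
      · simp only [List.length_cons]; omega
    obtain ⟨i, c⟩ := l
    by_cases hc : c = 1
    · subst hc
      exact .inr ⟨w, v, hv, by rw [word_cons, of_one, one_mul], by simp⟩
    rcases blocked_or (Γ := Γ) i w with h | h | ⟨L₁, d, L₂, rfl, h⟩
    · exact .inl ⟨ih, hc, h.append v⟩
    · rcases blocked_or (Γ := Γ) i v with h' | h' | ⟨L₁, d, L₂, rfl, h'⟩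
      · exact .inl ⟨ih, hc, h'.append_of_adj h⟩
      · refine .inr ⟨w, ⟨i, c⟩ :: v, List.pairwise_cons.2 ⟨h', hv⟩, ?_, ?_⟩
        · rw [word_cons, word_cons, of_mul_word h, mul_assoc]
        · simp only [List.length_cons]; omega
      · refine .inr ⟨w, L₁ ++ ⟨i, c * d⟩ :: L₂, ?_, ?_, ?_⟩
        · simpa [IsCliqueWord, List.pairwise_append] using hv
        · rw [← of_mul_word_append h', word_cons, of_mul_word h, mul_assoc]
        · simp
    · refine .inr ⟨L₁ ++ ⟨i, c * d⟩ :: L₂, v, hv, ?_, ?_⟩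
      · rw [← of_mul_word_append h, word_cons]
      · simp

theorem persistent_of_forall {v : List (Σ i, M i)} (h : ∀ l ∈ v, ∀ d, l.2 * d ≠ 1) :
    Persistent Γ v := by
  induction v with
  | nil => trivial
  | cons l v ih => exact ⟨ih fun l hl => h l (by simp [hl]), .inl (h l (by simp))⟩

theorem IsCliqueWord.word_eq_mul_of {L₁ L₂ : List (Σ i, M i)} {i : V} {c : M i}
    (h : IsCliqueWord Γ (L₁ ++ ⟨i, c⟩ :: L₂)) :
    word Γ M (L₁ ++ ⟨i, c⟩ :: L₂) = word Γ M (L₁ ++ L₂) * of Γ M i c := by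
  have : ∀ l ∈ L₂, Γ.Adj i l.1 := by
    simp only [IsCliqueWord, List.pairwise_append, List.pairwise_cons] at h
    exact h.2.1.1
  rw [word_append, word_cons, of_mul_word this, word_append, mul_assoc]

/-- The inverse is a product of inverses of the letters. The commutation clause lets the induction
move the new letter past `b`. -/
theorem IsCliqueWord.exists_inverse (hM : ∀ i, IsRegularMonoid (M i)) {v : List (Σ i, M i)}
    (h : IsCliqueWord Γ v) : ∃ b, word Γ M v = word Γ M v * b * word Γ M v ∧
      ∀ i, (∀ l ∈ v, Γ.Adj i l.1) → ∀ c, Commute (of Γ M i c) b := by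
  induction v with
  | nil => exact ⟨1, by simp, fun _ _ _ => Commute.one_right _⟩
  | cons l v ih =>
    obtain ⟨hl, hv⟩ := List.pairwise_cons.1 h
    obtain ⟨b, hb, hcomm⟩ := ih hv
    obtain ⟨d, hd⟩ := hM l.1 l.2
    refine ⟨of Γ M l.1 d * b, ?_, fun i hi c => ?_⟩
    · have h₁ : Commute (of Γ M l.1 d) (word Γ M v) := of_mul_word hl d
      have h₂ : Commute (of Γ M l.1 l.2) (word Γ M v) := of_mul_word hl l.2
      have h₃ : Commute (of Γ M l.1 l.2) b := hcomm _ hl _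
      have h₄ : Commute (of Γ M l.1 l.2) (word Γ M v * b) := h₂.mul_right h₃
      calc word Γ M (l :: v)
          = of Γ M l.1 l.2 * of Γ M l.1 d * of Γ M l.1 l.2 *
              (word Γ M v * b * word Γ M v) := by
            rw [← hb, ← of_mul, ← of_mul, ← hd, word_cons]
        _ = of Γ M l.1 l.2 * of Γ M l.1 d * (of Γ M l.1 l.2 * (word Γ M v * b)) *
              word Γ M v := by simp only [mul_assoc]
        _ = of Γ M l.1 l.2 * (of Γ M l.1 d * word Γ M v) * b * of Γ M l.1 l.2 *
              word Γ M v := by rw [h₄.eq]; simp only [mul_assoc]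
        _ = _ := by rw [h₁.eq, word_cons]; simp only [mul_assoc]
    · exact Commute.mul_right (of_comm (hi l (by simp)) c d)
        (hcomm i (fun l hl => hi l (by simp [hl])) c)

end GraphProduct

/-- If `a` is `L*`-related to an idempotent and `r` has a right inverse, then `a * r` is
`L*`-related to an idempotent. -/
theorem exists_lStar_mul_of_mul_eq_one {S : Type*} [Monoid S] {a r s : S}
    (h : ∃ e, IsIdempotentElem e ∧ LStar a e) (hrs : r * s = 1) :
    ∃ e, IsIdempotentElem e ∧ LStar (a * r) e := by
  obtain ⟨e, he, hae⟩ := h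
  have key (x : S) : r * (s * x) = x := by rw [← mul_assoc, hrs, one_mul]
  -- Conjugating `e` by the pair `s`, `r` keeps it idempotent since `r * s = 1`, and left
  -- multiplication by `r` recovers `e * r`.
  refine ⟨s * (e * r), ?_, fun x y => ?_⟩
  · rw [IsIdempotentElem]
    simp only [mul_assoc, key]
    rw [← mul_assoc e e, he.eq]
  · rw [mul_assoc, mul_assoc, hae]
    constructor
    · intro h
      simp only [mul_assoc, h]
    · intro h
      simpa only [mul_assoc, key] using congrArg (r * ·) h

/-! ### Right abundance -/

namespace GraphProduct

variable {V : Type u} {Γ : SimpleGraph V} {M : V → Type v} [∀ i, Monoid (M i)]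

theorem exists_lStar_word_mul_word (hM : ∀ i, IsRegularMonoid (M i)) (n : ℕ)
    (w v : List (Σ i, M i)) (hv : IsCliqueWord Γ v) (hn : 2 * w.length + v.length = n) :
    ∃ e, IsIdempotentElem e ∧ LStar (word Γ M w * word Γ M v) e := by
  induction n using Nat.strong_induction_on generalizing w v with | _ n ih
  by_cases hinv : ∃ l ∈ v, ∃ d, l.2 * d = 1
  · obtain ⟨⟨i, c⟩, hl, d, hd⟩ := hinv
    obtain ⟨L₁, L₂, rfl⟩ := List.append_of_mem hl
    rw [hv.word_eq_mul_of, ← mul_assoc]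
    refine exists_lStar_mul_of_mul_eq_one (s := of Γ M i d) (ih _ ?_ w (L₁ ++ L₂) ?_ rfl) ?_
    · simp only [List.length_append, List.length_cons] at hn ⊢
      omega
    · exact hv.sublist (by simp)
    · rw [← of_mul, hd, of_one]
  push Not at hinv
  rcases blockedOver_or_exists_shorter w hv with h | ⟨w', v', hv', h, hlt⟩
  · obtain ⟨b, hb, -⟩ := hv.exists_inverse hM
    -- Here `v = v * b * v`, so `b * v` is idempotent and `L*`-related to `v`; the prefix `w`
    -- cancels.
    refine ⟨b * word Γ M v, ?_, fun x y => ⟨fun hxy => ?_, fun hxy => ?_⟩⟩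
    · rw [IsIdempotentElem, mul_assoc, ← mul_assoc _ b, ← hb]
    · rw [mul_assoc, mul_assoc] at hxy
      rw [mul_assoc, mul_assoc, h.cancel (persistent_of_forall hinv) hxy]
    · rw [hb]
      simp only [mul_assoc] at hxy ⊢
      rw [hxy]
  · rw [← h]
    exact ih _ (hn ▸ hlt) w' v' hv' rfl

theorem isRightAbundant (Γ : SimpleGraph V) (hM : ∀ i, IsRegularMonoid (M i)) :
    IsRightAbundant (GraphProduct Γ M) := by
  intro a
  obtain ⟨w, rfl⟩ := exists_word_eq a
  simpa using exists_lStar_word_mul_word hM _ w [] List.Pairwise.nil rfl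

/-! ### Left abundance by duality -/

open MulOpposite

variable (Γ M) in
/-- The canonical map from a graph product to the opposite of the graph product of the opposite
monoids. -/
def toOp : GraphProduct Γ M →* (GraphProduct Γ fun i => (M i)ᵐᵒᵖ)ᵐᵒᵖ :=
  PresentedMonoid.lift (fun l => op (of Γ (fun i => (M i)ᵐᵒᵖ) l.1 (op l.2))) (by
    intro a b h
    cases h with
    | id i => exact congrArg op (of_one i)
    | vertex i x y => exact congrArg op (of_mul (M := fun i => (M i)ᵐᵒᵖ) i (op y) (op x)).symm
    | edge i j h x y => exact congrArg op (of_comm (M := fun i => (M i)ᵐᵒᵖ) h.symm (op y) (op x)))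

variable (Γ M) in
/-- The inverse of `toOp`. -/
def ofOp : (GraphProduct Γ fun i => (M i)ᵐᵒᵖ) →* (GraphProduct Γ M)ᵐᵒᵖ :=
  PresentedMonoid.lift (fun l => op (of Γ M l.1 (unop l.2))) (by
    intro a b h
    cases h with
    | id i => exact congrArg op (of_one i)
    | vertex i x y => exact congrArg op (of_mul i (unop y) (unop x)).symm
    | edge i j h x y => exact congrArg op (of_comm h.symm (unop y) (unop x)))

theorem toOp_of (i : V) (c : M i) :
    toOp Γ M (of Γ M i c) = op (of Γ (fun i => (M i)ᵐᵒᵖ) i (op c)) := rfl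

theorem ofOp_of (i : V) (c : (M i)ᵐᵒᵖ) :
    ofOp Γ M (of Γ (fun i => (M i)ᵐᵒᵖ) i c) = op (of Γ M i (unop c)) := rfl

theorem ofOp_unop_toOp (z : GraphProduct Γ M) : ofOp Γ M (unop (toOp Γ M z)) = op z := by
  induction z using of_mul_induction with
  | one => simp
  | of_mul i c z ih => simp [toOp_of, ofOp_of, ih]

theorem toOp_unop_ofOp (z : GraphProduct Γ fun i => (M i)ᵐᵒᵖ) :
    toOp Γ M (unop (ofOp Γ M z)) = op z := by
  induction z using of_mul_induction with
  | one => simp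
  | of_mul i c z ih => simp [toOp_of, ofOp_of, ih]

variable (Γ M) in
/-- The opposite of a graph product is the graph product of the opposite monoids. -/
def opEquiv : GraphProduct Γ M ≃* (GraphProduct Γ fun i => (M i)ᵐᵒᵖ)ᵐᵒᵖ where
  toFun := toOp Γ M
  invFun z := unop (ofOp Γ M (unop z))
  left_inv z := congrArg unop (ofOp_unop_toOp z)
  right_inv z := toOp_unop_ofOp (unop z)
  map_mul' := map_mul _

end GraphProduct

theorem IsRegularMonoid.op {S : Type*} [Monoid S] (h : IsRegularMonoid S) :
    IsRegularMonoid Sᵐᵒᵖ := by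
  intro a
  obtain ⟨b, hb⟩ := h a.unop
  refine ⟨MulOpposite.op b, MulOpposite.unop_injective ?_⟩
  simpa [mul_assoc] using hb

theorem IsRightAbundant.isLeftAbundant_of_equiv {S T : Type*} [Monoid S] [Monoid T]
    (h : IsRightAbundant T) (φ : S ≃* Tᵐᵒᵖ) : IsLeftAbundant S := by
  intro a
  obtain ⟨e, he, hae⟩ := h (φ a).unop
  refine ⟨φ.symm (MulOpposite.op e), ?_, fun x y => ?_⟩
  · rw [IsIdempotentElem, ← map_mul, ← MulOpposite.op_mul, he.eq]
  · have := hae (φ x).unop (φ y).unop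
    simp only [← MulOpposite.unop_mul, MulOpposite.unop_inj, ← map_mul, φ.injective.eq_iff] at this
    rw [this, ← φ.injective.eq_iff, map_mul, map_mul, φ.apply_symm_apply,
      ← MulOpposite.unop_injective.eq_iff]
    rfl

theorem GraphProduct.isAbundant {V : Type u} (Γ : SimpleGraph V) {M : V → Type v}
    [∀ i, Monoid (M i)] (hM : ∀ i, IsRegularMonoid (M i)) : IsAbundant (GraphProduct Γ M) :=
  ⟨(isRightAbundant Γ fun i => (hM i).op).isLeftAbundant_of_equiv (opEquiv Γ M),
    isRightAbundant Γ hM⟩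

/-! ### Failure of regularity -/

namespace GraphProduct

open Classical in
/-- The retraction of a graph product onto a vertex monoid. -/
noncomputable def toVertex {V : Type u} (Γ : SimpleGraph V) (M : V → Type v) [∀ i, Monoid (M i)]
    (i : V) : GraphProduct Γ M →* M i :=
  PresentedMonoid.lift (fun l => Pi.mulSingle l.1 l.2 i) (by
    intro a b h
    cases h with
    | id j => simp
    | vertex j x y =>
      simp only [map_mul, FreeMonoid.lift_eval_of, Pi.mulSingle_mul, Pi.mul_apply]
    | edge j k h x y =>
      simp only [map_mul, FreeMonoid.lift_eval_of]
      exact congrFun (Pi.mulSingle_commute h.ne x y).eq i)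

theorem toVertex_of_same {V : Type u} (Γ : SimpleGraph V) (M : V → Type v) [∀ i, Monoid (M i)]
    (i : V) (c : M i) : toVertex Γ M i (of Γ M i c) = c := by
  classical
  exact (Pi.mulSingle_eq_same i c :)

theorem toVertex_of_ne {V : Type u} (Γ : SimpleGraph V) (M : V → Type v) [∀ i, Monoid (M i)]
    {i j : V} (h : i ≠ j) (c : M j) : toVertex Γ M i (of Γ M j c) = 1 := by
  classical
  exact (Pi.mulSingle_eq_of_ne h c :)

/-- As `n` has no right inverse, it shields `m` from everything to its right, so `m` cancels from `m
n = m n b m n`. The retraction onto `M i` kills `n` and turns `n = n b m n` into a left inverse of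
`m`. -/
theorem not_isVonNeumannRegular_of_mul_of {V : Type u} {Γ : SimpleGraph V} {M : V → Type v}
    [∀ i, Monoid (M i)] {i j : V} (hne : i ≠ j) (hij : ¬ Γ.Adj i j) {m : M i} {n : M j}
    (hm : ¬ ∃ b, b * m = 1) (hn : ¬ ∃ b, n * b = 1) :
    ¬ IsVonNeumannRegular (of Γ M i m * of Γ M j n) := by
  rintro ⟨b, hb⟩
  push Not at hn
  have h₁ : of Γ M i m * (of Γ M j n * 1) =
      of Γ M i m * (of Γ M j n * (b * (of Γ M i m * of Γ M j n))) := by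
    simpa only [mul_assoc, mul_one] using hb
  have h₂ := congrArg (toVertex Γ M i) (of_mul_cancel
    (notInitial_of_mul_of_not_adj hne hij hn _) (notInitial_of_mul_of_not_adj hne hij hn _) h₁)
  simp only [map_mul, toVertex_of_same, toVertex_of_ne Γ M hne, one_mul, mul_one] at h₂
  exact hm ⟨_, h₂.symm⟩

end GraphProduct

theorem isRegularMonoid_zmod_two : IsRegularMonoid (ULift.{v} (ZMod 2)) := by
  rintro ⟨a⟩
  refine ⟨⟨a⟩, ULift.ext _ _ ?_⟩
  revert a
  decide

theorem corollary5p20 :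
    -- a graph product of regular monoids is abundant
    (∀ (V : Type u) (Γ : SimpleGraph V) (M : V → Type v) [∀ i, Monoid (M i)],
      (∀ i, IsRegularMonoid (M i)) → IsAbundant (GraphProduct Γ M)) ∧
    -- in the free product of two regular monoids, the product of two elements without
    -- one-sided inverses is not regular
    (∀ (M : Fin 2 → Type v) [∀ i, Monoid (M i)], (∀ i, IsRegularMonoid (M i)) →
      ∀ (m : M 0) (n : M 1),
        (¬ ∃ b, b * m = 1) → (¬ ∃ b, m * b = 1) →
        (¬ ∃ b, b * n = 1) → (¬ ∃ b, n * b = 1) →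
        ¬ IsVonNeumannRegular
          (GraphProduct.of (⊥ : SimpleGraph (Fin 2)) M 0 m *
            GraphProduct.of (⊥ : SimpleGraph (Fin 2)) M 1 n)) ∧
    -- hence there are graph products of regular monoids that are not regular
    (∃ (M : Fin 2 → Type v) (_ : ∀ i, Monoid (M i)),
      (∀ i, IsRegularMonoid (M i)) ∧
        ¬ IsRegularMonoid (GraphProduct (⊥ : SimpleGraph (Fin 2)) M)) := by
  refine ⟨fun V Γ M _ hM => GraphProduct.isAbundant Γ hM, fun M _ _ m n hm _ _ hn =>
    GraphProduct.not_isVonNeumannRegular_of_mul_of (by simp) (by simp) hm hn,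
    fun _ => ULift (ZMod 2), fun _ => inferInstance, fun _ => isRegularMonoid_zmod_two,
    fun h => ?_⟩
  -- Both factors are the multiplicative monoid of `ZMod 2`, where `0` is regular but has no
  -- one-sided inverse.
  have hne : (0 : ULift.{v} (ZMod 2)) ≠ 1 := zero_ne_one
  refine GraphProduct.not_isVonNeumannRegular_of_mul_of (Γ := (⊥ : SimpleGraph (Fin 2)))
    (M := fun _ => ULift.{v} (ZMod 2)) (i := 0) (j := 1) (m := 0) (n := 0) (by simp) (by simp)
    ?_ ?_ (h _)
  · rintro ⟨b, hb⟩
    exact hne (by rw [← hb, mul_zero])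
  · rintro ⟨b, hb⟩
    exact hne (by rw [← hb, zero_mul])
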